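/- Let $A,B,C\in\mathrm{SL}(3,\mathbb{C})$ satisfy $CBA=I$ and $$\mathrm{tr}(A^{-1})=\mathrm{tr}(A),\quad \mathrm{tr}(B^{-1})=\mathrm{tr}(B),\quad \mathrm{tr}(C^{-1})=\mathrm{tr}(C),\quad \mathrm{tr}([A,B]^{-1})=\mathrm{tr}([A,B]),$$ where $[A,B]=ABA^{-1}B^{-1}$. Define the shape invariants $$\sigma_+=\mathrm{tr}(A^{-1}B)-\mathrm{tr}(A^{-1})\,\mathrm{tr}(B),\qquad \sigma_-=\mathrm{tr}(B^{-1}A)-\mathrm{tr}(B^{-1})\,\mathrm{tr}(A),$$ and suppose that $\sigma_+=\sigma_-$. If $\sigma_+=3-\mathrm{tr}(A)-\mathrm{tr}(B)-\mathrm{tr}(C)$, then the subgroup $\langle A,B,C\rangle$ of $\mathrm{SL}(3,\mathbb{C})$ generated by $A,B,C$ is reducible, that is, there is a linear subspace $W$ of $\mathbb{C}^3$ with $W\neq\{0\}$ and $W\neq\mathbb{C}^3$ which is mapped into itself by every element of $\langle A,B,C\rangle$. -/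

import Mathlib

open scoped MatrixGroups commutatorElement

noncomputable section

/-- The trace of an element of `SL(3,ℂ)`. -/
def slTrace (A : SL(3, ℂ)) : ℂ := Matrix.trace (A : Matrix (Fin 3) (Fin 3) ℂ)

/-- The shape invariant `σ₊ = tr(A⁻¹B) - tr(A⁻¹) tr(B)` of a triple `(A, B, C)` with `CBA = I`
(its formula involves only `A` and `B`). -/
def shapePlus (A B : SL(3, ℂ)) : ℂ := slTrace (A⁻¹ * B) - slTrace A⁻¹ * slTrace B

/-- The shape invariant `σ₋ = tr(B⁻¹A) - tr(B⁻¹) tr(A)` of a triple `(A, B, C)` with `CBA = I`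
(its formula involves only `A` and `B`). -/
def shapeMinus (A B : SL(3, ℂ)) : ℂ := slTrace (B⁻¹ * A) - slTrace B⁻¹ * slTrace A

/-- The action of a subgroup `G` of `SL(3,ℂ)` on the column vectors `ℂ³`, as a representation. -/
def standardRep (G : Subgroup SL(3, ℂ)) : Representation ℂ G (Fin 3 → ℂ) where
  toFun g := Matrix.toLin' ((g : SL(3, ℂ)) : Matrix (Fin 3) (Fin 3) ℂ)
  map_one' := by simp; rfl
  map_mul' g h := by simp [Matrix.toLin'_mul]; rfl

/-- A subgroup of `SL(3,ℂ)` is reducible if its action on `ℂ³` is not irreducible, that is, if some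
subspace other than `0` and `ℂ³` is invariant under it. -/
def IsReducibleSubgroup (G : Subgroup SL(3, ℂ)) : Prop := ¬ (standardRep G).IsIrreducible

end

open Matrix

local notation:1024 "↑ₘ" A:1024 => ((A : SL(3, ℂ)) : Matrix (Fin 3) (Fin 3) ℂ)

/-! `A` and `B` share an eigenvector or an eigencovector, hence preserve a line or a plane. Since
`tr A⁻¹ = tr A`, the characteristic polynomial of `A` vanishes at `1`, and `1` is a simple root iff
`tr A ≠ 3`. If it is simple, `A` is conjugate to `1 ⊕ A'`. Write `B` in blocks with corner `b00`,
row `r`, column `c` and block `B'`. The trace identities give `b00 = 1` and `r c = r A' c = r B' c =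
0`, and in dimension two this forces `r = 0`, `c = 0`, or `r` to be a common eigencovector of `A'`
and `B'` (`haveCommonEigenvector_of_split`). By symmetry there remains the case where both are
unipotent: a full Jordan block is handled by `haveCommonEigenvector_of_jordan`, and otherwise the
two fixed spaces have dimension at least two and meet. -/

lemma SL3.coe_one : ↑ₘ(1 : SL(3, ℂ)) = 1 := rfl

lemma SL3.coe_mul (A B : SL(3, ℂ)) : ↑ₘ(A * B) = ↑ₘA * ↑ₘB := rfl

lemma SL3.coe_inv (A : SL(3, ℂ)) : ↑ₘ(A⁻¹) = adjugate ↑ₘA := rfl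

/-- The traces of `A`, `B`, `AB`, `A⁻¹B` agree with those of the inverses, and the shape invariant
has the value forcing reducibility. -/
structure SelfDualTraces (A B : SL(3, ℂ)) : Prop where
  left : slTrace A⁻¹ = slTrace A
  right : slTrace B⁻¹ = slTrace B
  mul : slTrace (A * B)⁻¹ = slTrace (A * B)
  inv_mul : slTrace (B⁻¹ * A) = slTrace (A⁻¹ * B)
  shape : slTrace (A⁻¹ * B) - slTrace A * slTrace B =
    3 - slTrace A - slTrace B - slTrace (A * B)

/-- `A` and `B` have a common eigenvector in the standard representation or in its dual. -/
def HaveCommonEigenvector (A B : SL(3, ℂ)) : Prop :=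
  (∃ v ≠ 0, (∃ a : ℂ, ↑ₘA *ᵥ v = a • v) ∧ ∃ b : ℂ, ↑ₘB *ᵥ v = b • v) ∨
    ∃ v ≠ 0, (∃ a : ℂ, v ᵥ* ↑ₘA = a • v) ∧ ∃ b : ℂ, v ᵥ* ↑ₘB = b • v

/-! ### Invariance under conjugation and under exchanging `A` and `B`. -/

lemma slTrace_mul_comm (A B : SL(3, ℂ)) : slTrace (A * B) = slTrace (B * A) := by
  exact Matrix.trace_mul_comm _ _

lemma slTrace_conj (P A : SL(3, ℂ)) : slTrace (P⁻¹ * A * P) = slTrace A := by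
  rw [slTrace_mul_comm, ← mul_assoc, mul_inv_cancel, one_mul]

lemma SelfDualTraces.symm {A B : SL(3, ℂ)} (h : SelfDualTraces A B) : SelfDualTraces B A where
  left := h.right
  right := h.left
  mul := by
    rw [_root_.mul_inv_rev, slTrace_mul_comm, ← _root_.mul_inv_rev, h.mul, slTrace_mul_comm]
  inv_mul := h.inv_mul.symm
  shape := by
    rw [h.inv_mul, slTrace_mul_comm B A]
    linear_combination h.shape

lemma SelfDualTraces.conj {A B : SL(3, ℂ)} (h : SelfDualTraces A B) (P : SL(3, ℂ)) :
    SelfDualTraces (P⁻¹ * A * P) (P⁻¹ * B * P) := by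
  have hinv : ∀ X : SL(3, ℂ), (P⁻¹ * X * P)⁻¹ = P⁻¹ * X⁻¹ * P := fun X => by group
  have hmul : ∀ X Y : SL(3, ℂ), P⁻¹ * X * P * (P⁻¹ * Y * P) = P⁻¹ * (X * Y) * P :=
    fun X Y => by group
  constructor <;> simp only [hinv, hmul, slTrace_conj]
  exacts [h.left, h.right, h.mul, h.inv_mul, h.shape]

lemma SL3.coe_mul_inv_cancel (P : SL(3, ℂ)) : ↑ₘP * ↑ₘ(P⁻¹) = 1 := by
  rw [← SL3.coe_mul, mul_inv_cancel, SL3.coe_one]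

lemma SL3.coe_inv_mul_cancel (P : SL(3, ℂ)) : ↑ₘ(P⁻¹) * ↑ₘP = 1 := by
  rw [← SL3.coe_mul, inv_mul_cancel, SL3.coe_one]

lemma SL3.mulVec_ne_zero (P : SL(3, ℂ)) {v : Fin 3 → ℂ} (hv : v ≠ 0) : ↑ₘP *ᵥ v ≠ 0 := by
  intro h
  apply hv
  rw [← one_mulVec v, ← SL3.coe_inv_mul_cancel P, ← mulVec_mulVec, h, mulVec_zero]

lemma SL3.vecMul_ne_zero (P : SL(3, ℂ)) {v : Fin 3 → ℂ} (hv : v ≠ 0) : v ᵥ* ↑ₘP ≠ 0 := by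
  intro h
  apply hv
  rw [← vecMul_one v, ← SL3.coe_mul_inv_cancel P, ← vecMul_vecMul, h, zero_vecMul]

lemma mulVec_of_conj {P A : SL(3, ℂ)} {v : Fin 3 → ℂ} {a : ℂ}
    (h : ↑ₘ(P⁻¹ * A * P) *ᵥ v = a • v) : ↑ₘA *ᵥ (↑ₘP *ᵥ v) = a • (↑ₘP *ᵥ v) := by
  rw [← mulVec_smul, ← h, mulVec_mulVec, mulVec_mulVec, ← SL3.coe_mul,
    ← SL3.coe_mul, show P * (P⁻¹ * A * P) = A * P by group]

lemma vecMul_of_conj {P A : SL(3, ℂ)} {v : Fin 3 → ℂ} {a : ℂ}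
    (h : v ᵥ* ↑ₘ(P⁻¹ * A * P) = a • v) : (v ᵥ* ↑ₘ(P⁻¹)) ᵥ* ↑ₘA = a • (v ᵥ* ↑ₘ(P⁻¹)) := by
  rw [← smul_vecMul, ← h, vecMul_vecMul, vecMul_vecMul, ← SL3.coe_mul,
    ← SL3.coe_mul, show P⁻¹ * A * P * P⁻¹ = P⁻¹ * A by group]

lemma HaveCommonEigenvector.of_conj {A B : SL(3, ℂ)} (P : SL(3, ℂ))
    (h : HaveCommonEigenvector (P⁻¹ * A * P) (P⁻¹ * B * P)) : HaveCommonEigenvector A B := by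
  rcases h with ⟨v, hv, ⟨a, ha⟩, b, hb⟩ | ⟨v, hv, ⟨a, ha⟩, b, hb⟩
  · exact .inl ⟨↑ₘP *ᵥ v, SL3.mulVec_ne_zero P hv, ⟨a, mulVec_of_conj ha⟩, b, mulVec_of_conj hb⟩
  · exact .inr ⟨v ᵥ* ↑ₘ(P⁻¹), SL3.vecMul_ne_zero _ hv, ⟨a, vecMul_of_conj ha⟩, b,
      vecMul_of_conj hb⟩

lemma HaveCommonEigenvector.symm {A B : SL(3, ℂ)} (h : HaveCommonEigenvector A B) :
    HaveCommonEigenvector B A :=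
  h.imp (fun ⟨v, hv, ha, hb⟩ => ⟨v, hv, hb, ha⟩) fun ⟨v, hv, ha, hb⟩ => ⟨v, hv, hb, ha⟩

/-! ### The case of a simple eigenvalue `1`. -/

/-- Two covectors of the plane annihilating the same nonzero vector are proportional. -/
lemma exists_eq_mul_of_annihilate {r₁ r₂ s₁ s₂ c₁ c₂ : ℂ} (hr : r₁ ≠ 0 ∨ r₂ ≠ 0)
    (hc : c₁ ≠ 0 ∨ c₂ ≠ 0) (h : r₁ * c₁ + r₂ * c₂ = 0) (h' : s₁ * c₁ + s₂ * c₂ = 0) :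
    ∃ k, s₁ = k * r₁ ∧ s₂ = k * r₂ := by
  have hd : s₁ * r₂ = s₂ * r₁ := by
    rcases hc with hc | hc
    · apply mul_left_cancel₀ hc
      linear_combination r₂ * h' - s₂ * h
    · apply mul_left_cancel₀ hc
      linear_combination s₁ * h - r₁ * h'
  rcases hr with hr | hr
  · refine ⟨s₁ / r₁, by field_simp, ?_⟩
    field_simp
    linear_combination -hd
  · refine ⟨s₂ / r₂, ?_, by field_simp⟩
    field_simp
    linear_combination hd

/-- The case where `A` splits as `1 ⊕ A'` and `1` is a simple eigenvalue. -/
lemma haveCommonEigenvector_of_split {A B : SL(3, ℂ)} (h : SelfDualTraces A B)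
    (htr : slTrace A ≠ 3) (h00 : ↑ₘA 0 0 = 1) (h01 : ↑ₘA 0 1 = 0) (h02 : ↑ₘA 0 2 = 0)
    (h10 : ↑ₘA 1 0 = 0) (h20 : ↑ₘA 2 0 = 0) : HaveCommonEigenvector A B := by
  obtain ⟨-, hB, hAB, hAiB, hs⟩ := h
  have dA := A.det_coe
  have dB := B.det_coe
  rw [det_fin_three] at dA dB
  simp only [slTrace, SL3.coe_inv, SL3.coe_mul, adjugate_mul_distrib,
    adjugate_fin_three, trace_fin_three, mul_apply, Fin.sum_univ_three,
    of_apply, cons_val] at hB hAB hAiB hs htr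
  simp only [h00, h01, h02, h10, h20] at hB hAB hAiB hs htr dA
  generalize hb00 : ↑ₘB 0 0 = b00 at *
  generalize hb01 : ↑ₘB 0 1 = b01 at *
  generalize hb02 : ↑ₘB 0 2 = b02 at *
  generalize hb10 : ↑ₘB 1 0 = b10 at *
  generalize hb11 : ↑ₘB 1 1 = b11 at *
  generalize hb12 : ↑ₘB 1 2 = b12 at *
  generalize hb20 : ↑ₘB 2 0 = b20 at *
  generalize hb21 : ↑ₘB 2 1 = b21 at *
  generalize hb22 : ↑ₘB 2 2 = b22 at *
  generalize ha11 : ↑ₘA 1 1 = a at *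
  generalize ha12 : ↑ₘA 1 2 = b at *
  generalize ha21 : ↑ₘA 2 1 = c at *
  generalize ha22 : ↑ₘA 2 2 = d at *
  -- This is `det (A' - 1)`, as `det A' = 1`.
  have ht : 2 - a - d ≠ 0 := fun e => htr (by linear_combination -e)
  have e00 : b00 = 1 := by
    apply mul_left_cancel₀ ht
    linear_combination hs - b00 * dA
  subst e00
  -- The minor is the corner entry of `B⁻¹`; the trace identities persist when `A` and `B` are both
  -- inverted, so it equals `1` for the same reason as `b00`.
  have eD : b11 * b22 - b12 * b21 = 1 := by
    apply mul_left_cancel₀ ht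
    linear_combination hs + hAiB + hAB - (a + d) * hB - (b11 * b22 - b12 * b21) * dA
  have o1 : b01 * b10 + b02 * b20 = 0 := by
    linear_combination -hB + eD
  have o2 : (b01 * b11 + b02 * b21) * b10 + (b01 * b12 + b02 * b22) * b20 = 0 := by
    linear_combination dB - eD + (b11 + b22) * o1
  have o3 : (b01 * a + b02 * c) * b10 + (b01 * b + b02 * d) * b20 = 0 := by
    linear_combination -hAB + (b11 * b22 - b12 * b21) * dA + eD
  by_cases hr : b01 ≠ 0 ∨ b02 ≠ 0
  · by_cases hc : b10 ≠ 0 ∨ b20 ≠ 0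
    · obtain ⟨k, k1, k2⟩ := exists_eq_mul_of_annihilate hr hc o1 o2
      obtain ⟨l, l1, l2⟩ := exists_eq_mul_of_annihilate hr hc o1 o3
      -- The covectors `r`, `r B'`, `r A'` all annihilate `c ≠ 0`, so they are proportional; `r c =
      -- 0` makes the first coordinate vanish.
      refine .inr ⟨![0, b01, b02], ?_, ⟨l, ?_⟩, k, ?_⟩
      · intro e
        have e1 := congrFun e 1
        have e2 := congrFun e 2
        simp at e1 e2
        simp [e1, e2] at hr
      · ext i
        fin_cases i <;> simp [vecMul, dotProduct, Fin.sum_univ_three, *]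
      · ext i
        fin_cases i <;> simp [vecMul, dotProduct, Fin.sum_univ_three, *]
    · push Not at hc
      refine .inl ⟨![1, 0, 0], fun e => by simpa using congrFun e 0, ⟨1, ?_⟩, 1, ?_⟩
      · ext i
        fin_cases i <;> simp [mulVec, dotProduct, Fin.sum_univ_three, *]
      · ext i
        fin_cases i <;> simp [mulVec, dotProduct, Fin.sum_univ_three, *]
  · push Not at hr
    refine .inr ⟨![1, 0, 0], fun e => by simpa using congrFun e 0, ⟨1, ?_⟩, 1, ?_⟩
    · ext i
      fin_cases i <;> simp [vecMul, dotProduct, Fin.sum_univ_three, *]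
    · ext i
      fin_cases i <;> simp [vecMul, dotProduct, Fin.sum_univ_three, *]

lemma exists_SL3_smul {M : Matrix (Fin 3) (Fin 3) ℂ} (hM : M.det ≠ 0) :
    ∃ (P : SL(3, ℂ)) (k : ℂ), ↑ₘP = k • M := by
  obtain ⟨k, hk⟩ := IsAlgClosed.exists_pow_nat_eq (M.det)⁻¹ (n := 3) (by norm_num)
  have hd : (k • M).det = 1 := by
    rw [det_smul, Fintype.card_fin, hk, inv_mul_cancel₀ hM]
  exact ⟨⟨k • M, hd⟩, k, rfl⟩

lemma exists_conj_eq {A : SL(3, ℂ)} {M J : Matrix (Fin 3) (Fin 3) ℂ} (hM : M.det ≠ 0)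
    (h : ↑ₘA * M = M * J) : ∃ P : SL(3, ℂ), ↑ₘ(P⁻¹ * A * P) = J := by
  obtain ⟨P, k, hP⟩ := exists_SL3_smul hM
  refine ⟨P, ?_⟩
  rw [SL3.coe_mul, SL3.coe_mul, mul_assoc]
  have : ↑ₘA * ↑ₘP = ↑ₘP * J := by rw [hP, mul_smul_comm, h, smul_mul_assoc]
  rw [this, ← mul_assoc, SL3.coe_inv_mul_cancel, one_mul]

lemma exists_det_ne_zero_mulVec_eq {v : Fin 3 → ℂ} (hv : v ≠ 0) :
    ∃ M : Matrix (Fin 3) (Fin 3) ℂ, M.det ≠ 0 ∧ ∀ i, M i 0 = v i := by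
  by_cases h0 : v 0 = 0
  · by_cases h1 : v 1 = 0
    · refine ⟨!![v 0, 1, 0; v 1, 0, 1; v 2, 0, 0], ?_, fun i => by fin_cases i <;> rfl⟩
      have h2 : v 2 ≠ 0 := fun h2 => hv (by ext i; fin_cases i <;> assumption)
      simpa [det_fin_three] using h2
    · exact ⟨!![v 0, 1, 0; v 1, 0, 0; v 2, 0, 1], by simpa [det_fin_three] using h1,
        fun i => by fin_cases i <;> rfl⟩
  · exact ⟨!![v 0, 0, 0; v 1, 1, 0; v 2, 0, 1], by simpa [det_fin_three] using h0,
      fun i => by fin_cases i <;> rfl⟩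

/-- In `SL(3)`, `det (A - 1) = tr A - tr A⁻¹`. -/
lemma exists_mulVec_eq_self {A : SL(3, ℂ)} (hA : slTrace A⁻¹ = slTrace A) :
    ∃ v ≠ 0, ↑ₘA *ᵥ v = v := by
  have hd : (↑ₘA - 1).det = 0 := by
    have dA := A.det_coe
    rw [det_fin_three] at dA
    simp only [slTrace, SL3.coe_inv, adjugate_fin_three, trace_fin_three, of_apply,
      cons_val] at hA
    rw [det_fin_three]
    simp [one_apply]
    linear_combination dA - hA
  obtain ⟨v, hv, h⟩ := exists_mulVec_eq_zero_iff.mpr hd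
  refine ⟨v, hv, ?_⟩
  rwa [sub_mulVec, one_mulVec, sub_eq_zero] at h

lemma exists_conj_split {A : SL(3, ℂ)} (hA : slTrace A⁻¹ = slTrace A) (htr : slTrace A ≠ 3) :
    ∃ P : SL(3, ℂ), ↑ₘ(P⁻¹ * A * P) 0 0 = 1 ∧ ↑ₘ(P⁻¹ * A * P) 0 1 = 0 ∧
      ↑ₘ(P⁻¹ * A * P) 0 2 = 0 ∧ ↑ₘ(P⁻¹ * A * P) 1 0 = 0 ∧ ↑ₘ(P⁻¹ * A * P) 2 0 = 0 := by
  obtain ⟨v, hv, hAv⟩ := exists_mulVec_eq_self hA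
  obtain ⟨M, hM, hM0⟩ := exists_det_ne_zero_mulVec_eq hv
  obtain ⟨P, k, hP⟩ := exists_SL3_smul hM
  have hPe : ↑ₘP *ᵥ ![1, 0, 0] = k • v := by
    ext i
    simp [hP, mulVec, dotProduct, Fin.sum_univ_three, hM0]
  obtain ⟨A₁, hA₁⟩ : ∃ A₁, A₁ = P⁻¹ * A * P := ⟨_, rfl⟩
  have hfix : ↑ₘA₁ *ᵥ ![1, 0, 0] = ![1, 0, 0] := by
    rw [hA₁, SL3.coe_mul, SL3.coe_mul, ← mulVec_mulVec, hPe,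
      ← mulVec_mulVec, mulVec_smul, hAv, ← hPe, mulVec_mulVec, SL3.coe_inv_mul_cancel, one_mulVec]
  have c0 := congrFun hfix 0
  have c1 := congrFun hfix 1
  have c2 := congrFun hfix 2
  simp [mulVec, dotProduct, Fin.sum_univ_three] at c0 c1 c2
  have htr₁ : slTrace A₁ ≠ 3 := by rwa [hA₁, slTrace_conj]
  have dA := A₁.det_coe
  rw [det_fin_three] at dA
  simp only [slTrace, trace_fin_three, c0] at htr₁
  simp only [c0, c1, c2] at dA
  generalize ha01 : ↑ₘA₁ 0 1 = p at *
  generalize ha02 : ↑ₘA₁ 0 2 = q at *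
  generalize ha11 : ↑ₘA₁ 1 1 = a at *
  generalize ha12 : ↑ₘA₁ 1 2 = b at *
  generalize ha21 : ↑ₘA₁ 2 1 = c at *
  generalize ha22 : ↑ₘA₁ 2 2 = d at *
  have ht : 2 - a - d ≠ 0 := fun e => htr₁ (by linear_combination -e)
  -- Cramer's rule for `(x, y)(A' - 1) = (p, q)`: the covector `(1, x, y)` is fixed by `A₁`, and its
  -- kernel is the invariant complement.
  let x := (p * (d - 1) - q * c) / (2 - a - d)
  let y := (q * (a - 1) - p * b) / (2 - a - d)
  have hx : p + x = x * a + y * c := by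
    simp only [x, y]
    field_simp
    linear_combination -p * dA
  have hy : q + y = x * b + y * d := by
    simp only [x, y]
    field_simp
    linear_combination -q * dA
  obtain ⟨Q, hQ⟩ := exists_conj_eq (A := A₁) (M := !![1, x, y; 0, 1, 0; 0, 0, 1])
    (J := !![1, 0, 0; 0, a, b; 0, c, d]) (by simp [det_fin_three]) (by
      ext i j
      fin_cases i <;> fin_cases j <;>
        simp [mul_apply, Fin.sum_univ_three, c0, c1, c2, ha01, ha02, ha11, ha12, ha21, ha22]
      · linear_combination hx
      · linear_combination hy)
  refine ⟨P * Q, ?_⟩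
  rw [show (P * Q)⁻¹ * A * (P * Q) = Q⁻¹ * A₁ * Q by rw [hA₁]; group, hQ]
  simp

lemma haveCommonEigenvector_of_slTrace_ne {A B : SL(3, ℂ)} (h : SelfDualTraces A B)
    (htr : slTrace A ≠ 3) : HaveCommonEigenvector A B := by
  obtain ⟨P, h00, h01, h02, h10, h20⟩ := exists_conj_split h.left htr
  exact .of_conj P (haveCommonEigenvector_of_split (h.conj P) (by rwa [slTrace_conj])
    h00 h01 h02 h10 h20)

/-! ### The unipotent case. -/

lemma haveCommonEigenvector_of_jordan {A B : SL(3, ℂ)} (h : SelfDualTraces A B)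
    (hJ : ↑ₘA = !![1, 1, 0; 0, 1, 1; 0, 0, 1]) : HaveCommonEigenvector A B := by
  obtain ⟨-, hB, hAB, hAiB, hs⟩ := h
  simp only [slTrace, SL3.coe_inv, SL3.coe_mul, adjugate_mul_distrib,
    hJ, adjugate_fin_three, trace_fin_three, mul_apply, Fin.sum_univ_three,
    of_apply, cons_val] at hB hAB hAiB hs
  have e20 : ↑ₘB 2 0 = 0 := by linear_combination hs
  -- With `e20`, either the first column or the last row of `B` is zero off the diagonal.
  have e : ↑ₘB 1 0 * ↑ₘB 2 1 = 0 := by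
    linear_combination hs + hAB + hAiB - 2 * hB + ↑ₘB 1 1 * e20
  rcases mul_eq_zero.mp e with e | e
  · refine .inl ⟨![1, 0, 0], fun e => by simpa using congrFun e 0, ⟨1, ?_⟩, ↑ₘB 0 0, ?_⟩
    · ext i
      fin_cases i <;> simp [hJ, mulVec, dotProduct, Fin.sum_univ_three]
    · ext i
      fin_cases i <;> simp [mulVec, dotProduct, Fin.sum_univ_three, *]
  · refine .inr ⟨![0, 0, 1], fun e => by simpa using congrFun e 2, ⟨1, ?_⟩, ↑ₘB 2 2, ?_⟩
    · ext i
      fin_cases i <;> simp [hJ, vecMul, dotProduct, Fin.sum_univ_three]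
    · ext i
      fin_cases i <;> simp [vecMul, dotProduct, Fin.sum_univ_three, *]

/-- Cayley–Hamilton: the characteristic polynomial is `(t - 1)³`. -/
lemma sub_one_pow_three_eq_zero {A : SL(3, ℂ)} (hA : slTrace A⁻¹ = slTrace A)
    (htr : slTrace A = 3) : (↑ₘA - 1) ^ 3 = 0 := by
  have hCH : adjugate ↑ₘA = ↑ₘA * ↑ₘA - slTrace A • ↑ₘA + slTrace A⁻¹ • (1 : Matrix _ _ ℂ) := by
    simp only [slTrace, SL3.coe_inv]
    ext i j
    fin_cases i <;> fin_cases j <;>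
      simp [adjugate_fin_three, trace_fin_three, mul_apply, Fin.sum_univ_three] <;> ring
  have h1 : ↑ₘA * adjugate ↑ₘA = 1 := by rw [mul_adjugate, A.det_coe, one_smul]
  rw [hCH, hA, htr] at h1
  have : (↑ₘA - 1) ^ 3 = ↑ₘA * (↑ₘA * ↑ₘA - (3 : ℂ) • ↑ₘA + (3 : ℂ) • 1) - 1 := by
    simp only [ofNat_smul_eq_nsmul ℂ 3]
    noncomm_ring
  rw [this, h1, sub_self]

lemma haveCommonEigenvector_of_sub_one_sq_ne_zero {A B : SL(3, ℂ)} (h : SelfDualTraces A B)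
    (htr : slTrace A = 3) (hN : (↑ₘA - 1) ^ 2 ≠ 0) : HaveCommonEigenvector A B := by
  have hN3 := sub_one_pow_three_eq_zero h.left htr
  obtain ⟨N, hNdef⟩ : ∃ N, N = ↑ₘA - 1 := ⟨_, rfl⟩
  rw [← hNdef] at hN hN3
  obtain ⟨w, hw⟩ : ∃ w, (N ^ 2) *ᵥ w ≠ 0 := by
    by_contra! hw
    exact hN (Matrix.ext_of_mulVec_single fun i => by rw [hw, zero_mulVec])
  have hA : ↑ₘA = N + 1 := by rw [hNdef, sub_add_cancel]
  have hNN : N *ᵥ (N *ᵥ w) = (N ^ 2) *ᵥ w := by rw [mulVec_mulVec, sq]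
  have hNNN : N *ᵥ ((N ^ 2) *ᵥ w) = 0 := by rw [mulVec_mulVec, ← pow_succ', hN3, zero_mulVec]
  -- The columns `N² w`, `N w`, `w` form a Jordan basis.
  obtain ⟨M, hM⟩ : ∃ M : Matrix (Fin 3) (Fin 3) ℂ, M = (of ![(N ^ 2) *ᵥ w, N *ᵥ w, w])ᵀ :=
    ⟨_, rfl⟩
  have hMx : ∀ x, M *ᵥ x = x 0 • (N ^ 2) *ᵥ w + x 1 • N *ᵥ w + x 2 • w := fun x => by
    ext i
    simp [hM, mulVec, dotProduct, Fin.sum_univ_three, mul_comm]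
  have hdet : M.det ≠ 0 := by
    intro h0
    obtain ⟨x, hx, hx0⟩ := exists_mulVec_eq_zero_iff.mpr h0
    rw [hMx] at hx0
    have s1 := congrArg (N *ᵥ ·) hx0
    simp only [mulVec_add, mulVec_smul, hNN, hNNN, mulVec_zero, smul_zero, zero_add] at s1
    have s2 := congrArg (N *ᵥ ·) s1
    simp only [mulVec_add, mulVec_smul, hNN, hNNN, mulVec_zero, smul_zero, zero_add] at s2
    have x2 : x 2 = 0 := (smul_eq_zero.mp s2).resolve_right hw
    rw [x2, zero_smul, add_zero] at s1 hx0
    have x1 : x 1 = 0 := (smul_eq_zero.mp s1).resolve_right hw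
    rw [x1, zero_smul, add_zero] at hx0
    have x0 : x 0 = 0 := (smul_eq_zero.mp hx0).resolve_right hw
    exact hx (by ext i; fin_cases i <;> assumption)
  obtain ⟨P, hP⟩ := exists_conj_eq (A := A) (J := !![1, 1, 0; 0, 1, 1; 0, 0, 1]) hdet (by
    apply Matrix.ext_of_mulVec_single
    intro j
    rw [← mulVec_mulVec, ← mulVec_mulVec, hMx, hMx, hA, add_mulVec, one_mulVec]
    simp only [mulVec_add, mulVec_smul, hNN, hNNN]
    fin_cases j <;> simp [mulVec, dotProduct, Fin.sum_univ_three, add_comm])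
  exact .of_conj P (haveCommonEigenvector_of_jordan (h.conj P) hP)

lemma two_le_finrank_ker {N : Matrix (Fin 3) (Fin 3) ℂ} (hN : N ^ 2 = 0) :
    2 ≤ Module.finrank ℂ (LinearMap.ker N.mulVecLin) := by
  have hle : LinearMap.range N.mulVecLin ≤ LinearMap.ker N.mulVecLin := by
    rintro _ ⟨v, rfl⟩
    rw [LinearMap.mem_ker, mulVecLin_apply, mulVecLin_apply, mulVec_mulVec, ← sq, hN, zero_mulVec]
  have h1 := Submodule.finrank_mono hle
  have h2 := N.mulVecLin.finrank_range_add_finrank_ker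
  rw [Module.finrank_fin_fun] at h2
  omega

lemma haveCommonEigenvector_of_sub_one_sq_eq_zero {A B : SL(3, ℂ)} (hA : (↑ₘA - 1) ^ 2 = 0)
    (hB : (↑ₘB - 1) ^ 2 = 0) : HaveCommonEigenvector A B := by
  have h1 := two_le_finrank_ker hA
  have h2 := two_le_finrank_ker hB
  have h3 := Submodule.finrank_sup_add_finrank_inf_eq (LinearMap.ker (↑ₘA - 1).mulVecLin)
    (LinearMap.ker (↑ₘB - 1).mulVecLin)
  have h4 := Submodule.finrank_le (LinearMap.ker (↑ₘA - 1).mulVecLin ⊔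
    LinearMap.ker (↑ₘB - 1).mulVecLin)
  rw [Module.finrank_fin_fun] at h4
  have h5 : LinearMap.ker (↑ₘA - 1).mulVecLin ⊓ LinearMap.ker (↑ₘB - 1).mulVecLin ≠ ⊥ := by
    intro h
    rw [h, finrank_bot] at h3
    omega
  obtain ⟨v, ⟨hvA, hvB⟩, hv⟩ := Submodule.exists_mem_ne_zero_of_ne_bot h5
  have key : ∀ X : Matrix (Fin 3) (Fin 3) ℂ, (X - 1).mulVecLin v = 0 → X *ᵥ v = (1 : ℂ) • v := by
    intro X hX
    rw [mulVecLin_apply, sub_mulVec, one_mulVec, sub_eq_zero] at hX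
    rw [hX, one_smul]
  exact .inl ⟨v, hv, ⟨1, key _ hvA⟩, 1, key _ hvB⟩

lemma SelfDualTraces.haveCommonEigenvector {A B : SL(3, ℂ)} (h : SelfDualTraces A B) :
    HaveCommonEigenvector A B := by
  by_cases hA : slTrace A = 3
  · by_cases hB : slTrace B = 3
    · by_cases hA2 : (↑ₘA - 1) ^ 2 = 0
      · by_cases hB2 : (↑ₘB - 1) ^ 2 = 0
        · exact haveCommonEigenvector_of_sub_one_sq_eq_zero hA2 hB2
        · exact (haveCommonEigenvector_of_sub_one_sq_ne_zero h.symm hB hB2).symm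
      · exact haveCommonEigenvector_of_sub_one_sq_ne_zero h hA hA2
    · exact (haveCommonEigenvector_of_slTrace_ne h.symm hB).symm
  · exact haveCommonEigenvector_of_slTrace_ne h hA

/-! ### From a common eigenvector or eigencovector to an invariant line or plane. -/

lemma isReducibleSubgroup_of_invariant {G : Subgroup SL(3, ℂ)} (W : Submodule ℂ (Fin 3 → ℂ))
    (hbot : W ≠ ⊥) (htop : W ≠ ⊤) (hW : ∀ g ∈ G, ∀ v ∈ W, ↑ₘg *ᵥ v ∈ W) :
    IsReducibleSubgroup G := by
  intro hirr
  let σ : Subrepresentation (standardRep G) :=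
    { toSubmodule := W
      apply_mem_toSubmodule := fun g v hv => hW g.1 g.2 v hv }
  rcases hirr.eq_bot_or_eq_top σ with h | h
  · exact hbot (congrArg Subrepresentation.toSubmodule h)
  · exact htop (congrArg Subrepresentation.toSubmodule h)

/-- The subgroup of elements having `v` as an eigenvector. -/
def eigenvectorStabilizer (v : Fin 3 → ℂ) (hv : v ≠ 0) : Subgroup SL(3, ℂ) where
  carrier := {g | ∃ a : ℂ, ↑ₘg *ᵥ v = a • v}
  one_mem' := ⟨1, by simp⟩
  mul_mem' := by
    rintro g h ⟨a, ha⟩ ⟨b, hb⟩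
    exact ⟨b * a, by rw [SL3.coe_mul, ← mulVec_mulVec, hb, mulVec_smul, ha,
      smul_smul]⟩
  inv_mem' := by
    rintro g ⟨a, ha⟩
    have ha0 : a ≠ 0 := by
      rintro rfl
      exact SL3.mulVec_ne_zero g hv (by rw [ha, zero_smul])
    refine ⟨a⁻¹, ?_⟩
    rw [eq_inv_smul_iff₀ ha0, ← mulVec_smul, ← ha, mulVec_mulVec, SL3.coe_inv_mul_cancel,
      one_mulVec]

/-- The subgroup of elements having `v` as an eigencovector. -/
def eigencovectorStabilizer (v : Fin 3 → ℂ) (hv : v ≠ 0) : Subgroup SL(3, ℂ) where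
  carrier := {g | ∃ a : ℂ, v ᵥ* ↑ₘg = a • v}
  one_mem' := ⟨1, by simp⟩
  mul_mem' := by
    rintro g h ⟨a, ha⟩ ⟨b, hb⟩
    exact ⟨a * b, by rw [SL3.coe_mul, ← vecMul_vecMul, ha, smul_vecMul, hb,
      smul_smul]⟩
  inv_mem' := by
    rintro g ⟨a, ha⟩
    have ha0 : a ≠ 0 := by
      rintro rfl
      exact SL3.vecMul_ne_zero g hv (by rw [ha, zero_smul])
    refine ⟨a⁻¹, ?_⟩
    rw [eq_inv_smul_iff₀ ha0, ← smul_vecMul, ← ha, vecMul_vecMul, SL3.coe_mul_inv_cancel,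
      vecMul_one]

lemma isReducibleSubgroup_of_le_eigenvectorStabilizer {G : Subgroup SL(3, ℂ)} {v : Fin 3 → ℂ}
    (hv : v ≠ 0) (hG : G ≤ eigenvectorStabilizer v hv) : IsReducibleSubgroup G := by
  refine isReducibleSubgroup_of_invariant (Submodule.span ℂ {v})
    (by simpa [Submodule.span_singleton_eq_bot] using hv) ?_ ?_
  · intro h
    have h1 := finrank_span_singleton (K := ℂ) hv
    rw [h, finrank_top, Module.finrank_fin_fun] at h1
    omega
  · intro g hg w hw
    obtain ⟨c, rfl⟩ := Submodule.mem_span_singleton.mp hw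
    obtain ⟨a, ha⟩ := hG hg
    rw [mulVec_smul, ha, smul_smul]
    exact Submodule.mem_span_singleton.mpr ⟨_, rfl⟩

lemma isReducibleSubgroup_of_le_eigencovectorStabilizer {G : Subgroup SL(3, ℂ)} {v : Fin 3 → ℂ}
    (hv : v ≠ 0) (hG : G ≤ eigencovectorStabilizer v hv) : IsReducibleSubgroup G := by
  refine isReducibleSubgroup_of_invariant (LinearMap.ker (dotProductBilin ℂ ℂ v)) ?_ ?_ ?_
  · intro h
    have h1 := (dotProductBilin ℂ ℂ v).finrank_range_add_finrank_ker
    have h2 := Submodule.finrank_le (LinearMap.range (dotProductBilin ℂ ℂ v))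
    rw [h, finrank_bot, Module.finrank_fin_fun] at h1
    rw [Module.finrank_self] at h2
    omega
  · intro h
    apply hv
    ext i
    have : Pi.single i 1 ∈ LinearMap.ker (dotProductBilin ℂ ℂ v) := h ▸ Submodule.mem_top
    simpa using this
  · intro g hg w hw
    obtain ⟨a, ha⟩ := hG hg
    have hw' : v ⬝ᵥ w = 0 := hw
    change v ⬝ᵥ (↑ₘg *ᵥ w) = 0
    rw [dotProduct_mulVec, ha, smul_dotProduct, hw', smul_zero]

lemma HaveCommonEigenvector.isReducibleSubgroup {A B : SL(3, ℂ)} (h : HaveCommonEigenvector A B)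
    {G : Subgroup SL(3, ℂ)} (hG : G ≤ Subgroup.closure {A, B}) : IsReducibleSubgroup G := by
  rcases h with ⟨v, hv, hA, hB⟩ | ⟨v, hv, hA, hB⟩
  · refine isReducibleSubgroup_of_le_eigenvectorStabilizer hv
      (hG.trans ((Subgroup.closure_le _).mpr ?_))
    rintro _ (rfl | rfl)
    exacts [hA, hB]
  · refine isReducibleSubgroup_of_le_eigencovectorStabilizer hv
      (hG.trans ((Subgroup.closure_le _).mpr ?_))
    rintro _ (rfl | rfl)
    exacts [hA, hB]

theorem theorem5p6 (A B C : SL(3, ℂ))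
    (hCBA : C * B * A = 1)
    (hA : slTrace A⁻¹ = slTrace A)
    (hB : slTrace B⁻¹ = slTrace B)
    (hC : slTrace C⁻¹ = slTrace C)
    (hAB : slTrace (⁅A, B⁆)⁻¹ = slTrace ⁅A, B⁆)
    (hσ : shapePlus A B = shapeMinus A B)
    (hred : shapePlus A B = 3 - slTrace A - slTrace B - slTrace C) :
    IsReducibleSubgroup (Subgroup.closure {A, B, C}) := by
  have hC' : C = (B * A)⁻¹ := eq_inv_of_mul_eq_one_left (by rw [← mul_assoc, hCBA])
  have hCtr : slTrace C = slTrace (A * B) := by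
    rw [← hC, hC', inv_inv, slTrace_mul_comm]
  have hsd : SelfDualTraces A B :=
    { left := hA
      right := hB
      mul := by
        rw [_root_.mul_inv_rev, slTrace_mul_comm, ← _root_.mul_inv_rev, ← hC', hCtr]
      inv_mul := by
        rw [shapePlus, shapeMinus, hA, hB] at hσ
        linear_combination -hσ
      shape := by rw [← hCtr, ← hred, shapePlus, hA] }
  refine hsd.haveCommonEigenvector.isReducibleSubgroup ((Subgroup.closure_le _).mpr ?_)
  have hmA : A ∈ Subgroup.closure {A, B} := Subgroup.subset_closure (by simp)
  have hmB : B ∈ Subgroup.closure {A, B} := Subgroup.subset_closure (by simp)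
  rintro _ (rfl | rfl | rfl)
  · exact hmA
  · exact hmB
  · rw [hC']
    exact inv_mem (mul_mem hmB hmA)
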